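/- Let $\Sigma$ be a (finite) ranked alphabet. A weighted tree grammar with equality constraints (WTGc) over $\mathbb N$ is a tuple $G=(Q,\Sigma,F,P,\mathrm{wt})$ with a finite set $Q$ of states, final weights $F\colon Q\to\mathbb N$, a finite set $P$ of productions $\ell\xrightarrow{E}q$ with $\ell\in T_\Sigma(Q)\setminus Q$, $q\in Q$ and $E\subseteq\mathbb N^*\times\mathbb N^*$ finite, and weights $\mathrm{wt}\colon P\to\mathbb N$. For $t\in T_\Sigma$, a production $p=(\ell\xrightarrow{E}q)$ and a position $w$, write $\xi\Rightarrow^{p,w}_{G,t}\zeta$ if $\xi|_w=\ell$, $\zeta=\xi[q]_w$, and $v,v'\in\mathrm{pos}(t|_w)$ with $(t|_w)|_v=(t|_w)|_{v'}$ for all $(v,v')\in E$. $D_G^q(t)$ denotes the set of complete left-most derivations for $t$ to $q$, i.e. of sequences $d=(p_1,w_1)\cdots(p_n,w_n)$ with $t=\xi_0\Rightarrow^{p_1,w_1}_{G,t}\cdots\Rightarrow^{p_n,w_n}_{G,t}\xi_n=q$ and $w_1\prec\dots\prec w_n$, where $\prec$ is the lexicographic order in which prefixes are larger. Put $\mathrm{wt}_G(d)=\prod_i\mathrm{wt}(p_i)$,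 $\mathrm{wt}_G^q(t)=\sum_{d\in D_G^q(t)}\mathrm{wt}_G(d)$ and $[\![G]\!](t)=\sum_{q\in Q,\,d\in D_G^q(t)}F(q)\,\mathrm{wt}_G(d)$. Let $\mathrm{ht}(t)$ be the maximal length of a position of $t$, and $\mathrm{ht}(G)=|Q|\cdot\max_{(\ell\xrightarrow{E}q)\in P}\mathrm{ht}(\ell)$. $G$ is a WTG if $E=\emptyset$ for all its productions, and a WTA if moreover the root is the only $\Sigma$-labelled position of every left-hand side $\ell$. A weighted tree language $T_\Sigma\to\mathbb N$ is regular if it equals $[\![H]\!]$ for some WTA $H$. A WTGh is a WTGc with a designated sink state $\bot\in Q$ such that $F(\bot)=0$; for every $\gamma\in\Sigma$ the production $p_\gamma=(\gamma(\bot,\dots,\bot)\xrightarrow{\emptyset}\bot)$ is in $P$ and has weight $1$; and for every production $\ell\xrightarrow{E}q$ the set $E$ is an equivalence relation on a set of state-labelled positions of $\ell$ such that in each class with at least two elements the $\prec$-least position is not labelled $\bot$ and all others are labelled $\bot$. It is trim if every production, except possibly the obligatory $p_\gamma$, occurs in some $d\in D_G^q(t)$ with $F(q)\cdot\mathrm{wt}_G(d)\ne0$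 for some $t\in T_\Sigma$, $q\in Q$. It has the large duplication property if there are a production $\ell\xrightarrow{E}q\in P$, a constraint $(u,v)\in E$ with $\ell(u)\neq\bot=\ell(v)$, and a tree $t\in T_\Sigma$ with $\mathrm{ht}(t)>\mathrm{ht}(G)$ and $D_G^{\ell(u)}(t)\ne\emptyset$. The linearization $\mathrm{lin}(G)$ of $G$ is the WTG with the same states, alphabet and final weights whose productions are obtained as follows. For a production $\ell\xrightarrow{E}q$ of $G$ let $w_1,\dots,w_k$ (listed once, in a fixed order) be the positions lying in classes of $E$ with at least two elements. For every choice of $t_1,\dots,t_k\in T_\Sigma$ with $t_i=t_j$ whenever $(w_i,w_j)\in E$, $\mathrm{ht}(t_i)\le\mathrm{ht}(G)$ and $D_G^{\ell(w_i)}(t_i)\neq\emptyset$ for all $i$, it has the production $\ell[t_1]_{w_1}\cdots[t_k]_{w_k}\to q$. The weight of a production of $\mathrm{lin}(G)$ is the sum, over all pairs of a production of $G$ and such a choice that yield it, of $\mathrm{wt}(\ell\xrightarrow{E}q)\cdot\prod_{i=1}^k\mathrm{wt}_G^{\ell(w_i)}(t_i)$. Proposition. Let $G$ be a trim WTGh that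 does not have the large duplication property. Then $[\![G]\!]$ is a regular weighted tree language. Moreover, $\mathrm{lin}(G)$, which is a WTG (it has no constraints), is equivalent to $G$: $[\![\mathrm{lin}(G)]\!]=[\![G]\!]$. -/

import Mathlib

/-- Trees `T_Σ(Z)` over the ranked alphabet `(S, rk)`, indexed by `Z`: a leaf `z ∈ Z`, or a symbol
`s` of rank `rk s` with `rk s` direct subtrees. The set `T_Σ` is `RankedTree rk Empty`. -/
inductive RankedTree {S : Type*} (rk : S → ℕ) (Z : Type*) : Type _
  | leaf (z : Z) : RankedTree rk Z
  | node (s : S) (ts : Fin (rk s) → RankedTree rk Z) : RankedTree rk Z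

namespace RankedTree

variable {S : Type*} {rk : S → ℕ} {Z : Type*}

/-- The inclusion `T_Σ ⊆ T_Σ(Z)`. -/
def embed : RankedTree rk Empty → RankedTree rk Z
  | leaf z => z.elim
  | node s ts => node s (fun i => (ts i).embed)

/-- The subtree `t|_w`, or `none` if `w` is not a position of `t`. Positions are words over `ℕ`;
the direct subtrees of a node are numbered from `0`. -/
def subtree? : RankedTree rk Z → List ℕ → Option (RankedTree rk Z)
  | t, [] => some t
  | leaf _, _ :: _ => none
  | node s ts, i :: w => if h : i < rk s then (ts ⟨i, h⟩).subtree? w else none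

/-- The substitution `t[r]_w` of `r` into `t` at the position `w`. -/
def replace : RankedTree rk Z → List ℕ → RankedTree rk Z → RankedTree rk Z
  | _, [], r => r
  | leaf z, _ :: _, _ => leaf z
  | node s ts, i :: w, r =>
      node s (fun j => if (j : ℕ) = i then (ts j).replace w r else ts j)

/-- The height of `t`: the maximal length of a position of `t`. -/
def height : RankedTree rk Z → ℕ
  | leaf _ => 0
  | node _ ts => Finset.univ.sup (fun i => (ts i).height + 1)

/-- Simultaneous substitution at leaves: the leaf at position `w` is replaced by `r` whenever
`θ w = some r`; all other positions are unchanged. -/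
def fill : RankedTree rk Z → (List ℕ → Option (RankedTree rk Z)) → RankedTree rk Z
  | leaf z, θ => (θ []).getD (leaf z)
  | node s ts, θ => node s (fun i => (ts i).fill (fun w => θ ((i : ℕ) :: w)))

/-- The set of positions of `t` that are labelled by symbols of the ranked alphabet. -/
def symbolPos (t : RankedTree rk Z) : Set (List ℕ) :=
  {w | ∃ s ts, t.subtree? w = some (node s ts)}

/-- `t ⊨ E`: for all `(v, v') ∈ E`, both `v` and `v'` are positions of `t` and `t|_v = t|_v'`. -/
def Satisfies (t : RankedTree rk Z) (E : Finset (List ℕ × List ℕ)) : Prop :=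
  ∀ e ∈ E, ∃ r, t.subtree? e.1 = some r ∧ t.subtree? e.2 = some r

theorem finite_height_lt [Finite S] (n : ℕ) :
    {t : RankedTree rk Empty | t.height < n}.Finite := by
  induction n with
  | zero => simp
  | succ n ih =>
    refine (Set.finite_iUnion (fun s : S => (Set.Finite.pi' (ι := Fin (rk s))
      (fun _ => ih)).image (node s))).subset ?_
    intro t ht
    cases t with
    | leaf z => exact z.elim
    | node s ts =>
      refine Set.mem_iUnion.2 ⟨s, ts, fun i => ?_, rfl⟩
      have h1 : (ts i).height + 1 ≤ (node s ts).height := by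
        rw [height]
        exact Finset.le_sup (f := fun i => (ts i).height + 1) (Finset.mem_univ i)
      have h2 : (node s ts).height < n + 1 := ht
      show (ts i).height < n
      omega

end RankedTree

/-- The strict lexicographic order `v ≺ w` on positions in which prefixes are larger
(so that the empty word is the largest position). -/
inductive PosLT : List ℕ → List ℕ → Prop
  | nil (i : ℕ) (v : List ℕ) : PosLT (i :: v) []
  | head {i j : ℕ} (v w : List ℕ) (h : i < j) : PosLT (i :: v) (j :: w)
  | tail (i : ℕ) {v w : List ℕ} (h : PosLT v w) : PosLT (i :: v) (i :: w)

/-- A production `lhs → tgt` with the finite set `eqs` of equality constraints. -/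
structure Production {S : Type*} (rk : S → ℕ) (Q : Type*) where
  lhs : RankedTree rk Q
  tgt : Q
  eqs : Finset (List ℕ × List ℕ)

/-- `ℓ(w) = q`: the left-hand side of `p` has the state `q` at the position `w`. -/
def Production.StateAt {S : Type*} {rk : S → ℕ} {Q : Type*} (p : Production rk Q)
    (w : List ℕ) (q : Q) : Prop :=
  p.lhs.subtree? w = some (.leaf q)

/-- Weighted tree grammars with equality constraints over the semiring `ℕ`, with state set `Q`.
Only the values of `wt` on `prods` are ever used. -/
structure WTGc {S : Type*} (rk : S → ℕ) (Q : Type*) where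
  final : Q → ℕ
  prods : Finset (Production rk Q)
  lhs_not_state : ∀ p ∈ prods, ∀ q, p.lhs ≠ .leaf q
  wt : Production rk Q → ℕ

namespace WTGc

variable {S : Type*} {rk : S → ℕ} {Q : Type*}

/-- The derivation step `ξ ⇒ ζ` for the input tree `t`, with the production `p` at position `w`. -/
def Step (G : WTGc rk Q) (t : RankedTree rk Empty) (p : Production rk Q) (w : List ℕ)
    (ξ ζ : RankedTree rk Q) : Prop :=
  p ∈ G.prods ∧ ξ.subtree? w = some p.lhs ∧ ζ = ξ.replace w (.leaf p.tgt) ∧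
    ∃ s, t.subtree? w = some s ∧ s.Satisfies p.eqs

/-- `G.Derives t ξ d ζ`: the sequence `d` of steps leads from `ξ` to `ζ`, for the input tree `t`. -/
inductive Derives (G : WTGc rk Q) (t : RankedTree rk Empty) :
    RankedTree rk Q → List (Production rk Q × List ℕ) → RankedTree rk Q → Prop
  | nil (ξ : RankedTree rk Q) : Derives G t ξ [] ξ
  | cons {ξ ζ χ : RankedTree rk Q} {p : Production rk Q} {w : List ℕ}
      {d : List (Production rk Q × List ℕ)}
      (h : G.Step t p w ξ ζ) (hd : Derives G t ζ d χ) : Derives G t ξ ((p, w) :: d) χ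

/-- The (finite) set `D_G^q(t)` of complete left-most derivations of `G` for `t` to `q`. -/
def derivations (G : WTGc rk Q) (q : Q) (t : RankedTree rk Empty) :
    Set (List (Production rk Q × List ℕ)) :=
  {d | G.Derives t t.embed d (.leaf q) ∧ d.Pairwise (fun a b => PosLT a.2 b.2)}

/-- The weight of a derivation. -/
def derivWt (G : WTGc rk Q) (d : List (Production rk Q × List ℕ)) : ℕ :=
  (d.map (fun a => G.wt a.1)).prod

/-- `wt_G^q(t)`: the sum of the weights of all complete left-most derivations for `t` to `q`. -/
noncomputable def stateWt (G : WTGc rk Q) (q : Q) (t : RankedTree rk Empty) : ℕ :=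
  ∑ᶠ d ∈ G.derivations q t, G.derivWt d

/-- The weighted tree language generated by `G`. -/
noncomputable def sem [Fintype Q] (G : WTGc rk Q) (t : RankedTree rk Empty) : ℕ :=
  ∑ q : Q, ∑ᶠ d ∈ G.derivations q t, G.final q * G.derivWt d

/-- The height of `G`: the number of its states times the maximal height of a left-hand side. -/
def height [Fintype Q] (G : WTGc rk Q) : ℕ :=
  Fintype.card Q * G.prods.sup (fun p => p.lhs.height)

/-- `G` is a weighted tree grammar: no production has equality constraints. -/
def IsWTG (G : WTGc rk Q) : Prop := ∀ p ∈ G.prods, p.eqs = ∅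

/-- `G` is a weighted tree automaton with equality constraints: the only position of a left-hand
side that is labelled by an input symbol is the root. -/
def IsWTAc (G : WTGc rk Q) : Prop := ∀ p ∈ G.prods, p.lhs.symbolPos = {[]}

/-- `G` is a weighted tree automaton. -/
def IsWTA (G : WTGc rk Q) : Prop := G.IsWTG ∧ G.IsWTAc

end WTGc

/-- A weighted tree language is regular if it is generated by a weighted tree automaton. -/
def IsRegularWTL {S : Type*} {rk : S → ℕ} (A : RankedTree rk Empty → ℕ) : Prop :=
  ∃ (Q : Type) (_ : Fintype Q) (H : WTGc rk Q), H.IsWTA ∧ H.sem = A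

/-- The production `γ(⊥, …, ⊥) → ⊥` without constraints. -/
def sinkProduction {S : Type*} {rk : S → ℕ} {Q : Type*} (bot : Q) (s : S) : Production rk Q where
  lhs := .node s (fun _ => .leaf bot)
  tgt := bot
  eqs := ∅

/-- WTGh: a WTGc with a designated nonfinal sink state `bot` in which the constraint set `E` of each
production is an equivalence relation on a set of state-labelled positions of the left-hand side,
and in each equivalence class all positions but the lexicographically least one carry `bot`, while
that least position does not carry `bot` if there are others. -/
structure WTGh {S : Type*} (rk : S → ℕ) (Q : Type*) extends WTGc rk Q where
  bot : Q
  final_bot : final bot = 0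
  sink_mem : ∀ s, sinkProduction bot s ∈ prods
  sink_wt : ∀ s, wt (sinkProduction bot s) = 1
  eqs_state : ∀ p ∈ prods, ∀ e ∈ p.eqs, (∃ q, p.StateAt e.1 q) ∧ (∃ q, p.StateAt e.2 q)
  eqs_symm : ∀ p ∈ prods, ∀ u v, (u, v) ∈ p.eqs → (v, u) ∈ p.eqs
  eqs_trans : ∀ p ∈ prods, ∀ u v w, (u, v) ∈ p.eqs → (v, w) ∈ p.eqs → (u, w) ∈ p.eqs
  eqs_guard : ∀ p ∈ prods, ∀ w v, (w, v) ∈ p.eqs → v ≠ w →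
    (∀ x, (w, x) ∈ p.eqs → x = w ∨ PosLT w x) → p.StateAt v bot ∧ ¬ p.StateAt w bot

namespace WTGh

variable {S : Type*} {rk : S → ℕ} {Q : Type*}

/-- `G` is trim: every production is used in some accepting derivation of nonzero weight. The
obligatory productions `γ(⊥, …, ⊥) → ⊥` of a WTGh, which cannot be removed, are exempt. -/
def IsTrim (G : WTGh rk Q) : Prop :=
  ∀ p ∈ G.prods, (∃ s, p = sinkProduction G.bot s) ∨
    ∃ t q, ∃ d ∈ G.derivations q t, G.final q * G.derivWt d ≠ 0 ∧ ∃ w, (p, w) ∈ d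

/-- The large duplication property. -/
def LargeDuplication [Fintype Q] (G : WTGh rk Q) : Prop :=
  ∃ p ∈ G.prods, ∃ u v, (u, v) ∈ p.eqs ∧ p.StateAt v G.bot ∧
    ∃ q, p.StateAt u q ∧ q ≠ G.bot ∧
      ∃ t, G.height < t.height ∧ (G.derivations q t).Nonempty

end WTGh

/-- The positions `w` that occur in a constraint `w = v` with `v ≠ w`. For a production of a WTGh
these are the positions in the classes `[w]_E` of the `⊥`-labelled positions `w`, where
the trivial classes `{w}` (which impose no constraint) are left out. -/
def Production.constrained {S : Type*} {rk : S → ℕ} {Q : Type*} (p : Production rk Q) :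
    Finset (List ℕ) :=
  (p.eqs.filter (fun e => e.1 ≠ e.2)).image Prod.fst

namespace WTGc

variable {S : Type*} {rk : S → ℕ} {Q : Type*}

/-- `θ` is an admissible choice of trees for the constrained positions of the production `p`: it
is defined exactly on these positions, respects the equality constraints, and its values are trees
of height at most the height of `G` that have a derivation to the state at their position. -/
def IsLinChoice [Fintype Q] (G : WTGc rk Q) (p : Production rk Q)
    (θ : List ℕ → Option (RankedTree rk Empty)) : Prop :=
  p ∈ G.prods ∧
  (∀ w, (θ w).isSome ↔ w ∈ p.constrained) ∧
  (∀ e ∈ p.eqs, θ e.1 = θ e.2) ∧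
  ∀ w t, θ w = some t → t.height ≤ G.height ∧
    ∃ q, p.StateAt w q ∧ (G.derivations q t).Nonempty

/-- The constraint-free production that results from `p` by the choice `θ`. -/
def linProduction (p : Production rk Q) (θ : List ℕ → Option (RankedTree rk Empty)) :
    Production rk Q where
  lhs := p.lhs.fill (fun w => (θ w).map RankedTree.embed)
  tgt := p.tgt
  eqs := ∅

/-- The weight `wt(p) · ∏ wt_G^{ℓ(w)}(θ(w))`, with the product over all constrained positions. -/
noncomputable def linWt (G : WTGc rk Q) (p : Production rk Q)
    (θ : List ℕ → Option (RankedTree rk Empty)) : ℕ :=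
  G.wt p * ∏ w ∈ p.constrained,
    match p.lhs.subtree? w, θ w with
    | some (.leaf q), some t => G.stateWt q t
    | _, _ => 1

theorem finite_linChoices [Finite S] [Fintype Q] (G : WTGc rk Q) :
    {x : Production rk Q × (List ℕ → Option (RankedTree rk Empty)) |
      G.IsLinChoice x.1 x.2}.Finite := by
  have key : ∀ p : Production rk Q, {θ | G.IsLinChoice p θ}.Finite := by
    intro p
    let B : Set (Option (RankedTree rk Empty)) :=
      insert none (some '' {t | t.height < G.height + 1})
    have hB : B.Finite := ((RankedTree.finite_height_lt _).image _).insert _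
    have hpi := Set.Finite.pi' (ι := {w // w ∈ p.constrained}) (fun _ => hB)
    refine Set.Finite.of_finite_image
      (f := fun θ => fun w : {w // w ∈ p.constrained} => θ w.1) (hpi.subset ?_) ?_
    · rintro _ ⟨θ, hθ, rfl⟩ w
      show θ w.1 ∈ B
      rcases h : θ w.1 with _ | t
      · exact Set.mem_insert _ _
      · exact Set.mem_insert_of_mem _ ⟨t, Nat.lt_succ_of_le (hθ.2.2.2 _ _ h).1, rfl⟩
    · intro θ hθ θ' hθ' h
      funext w
      by_cases hw : w ∈ p.constrained
      · exact congrFun h ⟨w, hw⟩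
      · have h1 := (hθ.2.1 w).not.2 hw
        have h2 := (hθ'.2.1 w).not.2 hw
        simp only [Option.not_isSome_iff_eq_none] at h1 h2
        rw [h1, h2]
  refine (Set.Finite.biUnion G.prods.finite_toSet
    (fun p _ => (key p).image (fun θ => (p, θ)))).subset ?_
  rintro ⟨p, θ⟩ h
  exact Set.mem_biUnion (Finset.mem_coe.2 h.1) ⟨θ, h, rfl⟩

/-- The linearization of `G`. A production `ℓ' → q` has as weight the sum of the weights of all
pairs of a production of `G` and an admissible choice that result in `ℓ' → q`. -/
noncomputable def lin [Finite S] [Fintype Q] (G : WTGc rk Q) : WTGc rk Q where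
  final := G.final
  prods := (G.finite_linChoices.image (fun x => linProduction x.1 x.2)).toFinset
  lhs_not_state := by
    intro p hp q hq
    rw [Set.Finite.mem_toFinset] at hp
    obtain ⟨⟨p, θ⟩, h, rfl⟩ := hp
    rcases hl : p.lhs with z | ⟨s, ts⟩
    · exact G.lhs_not_state p h.1 z hl
    · simp [linProduction, hl, RankedTree.fill] at hq
  wt := fun p' => ∑ᶠ x ∈ {x : Production rk Q × (List ℕ → Option (RankedTree rk Empty)) |
    G.IsLinChoice x.1 x.2 ∧ linProduction x.1 x.2 = p'}, G.linWt x.1 x.2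

end WTGc

/-! Derivations enter only through `treeWt t l`, the total weight of left-most derivations from `t`
to an arbitrary tree `l` over the states. It satisfies two recurrences: it is multiplicative over
direct subtrees when the root symbols agree (`treeWt_node`), and for a state it is the sum, over the
productions into that state whose constraints `t` satisfies, of the production weight times the
weight of reaching the left-hand side (`treeWt_leaf`).

For the linearization, fix `t` and a production that contributes nonzero weight at the root of `t`.
Every constrained position lies in a class whose least position carries a state other than ⊥ and
which also contains a ⊥. The subtree of `t` at that least position derives to its state, so without
large duplication its height is at most the height of `G`; the constraints transfer the bound to the
whole class (`height_le_of_not_largeDuplication`). Hence the subtrees of `t` at the constrained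
positions form an admissible choice. It is the only choice whose filled left-hand side is compatible
with `t`, and it contributes exactly what the production contributes in `G`
(`prod_linFactor_mul_treeWt_fill`). Induction on `t` gives `treeWt_lin`.

For regularity, a grammar without constraints becomes an automaton whose states are the states and
the subtrees of left-hand sides: a left-hand side is recognized one symbol at a time
(`treeWt_flatten`). -/

/-! ### The order on positions. -/

theorem PosLT.not_nil_left {w : List ℕ} : ¬ PosLT [] w := by
  intro h; cases h

theorem PosLT.cons_cons {i j : ℕ} {v w : List ℕ} :
    PosLT (i :: v) (j :: w) ↔ i < j ∨ i = j ∧ PosLT v w := by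
  constructor
  · intro h
    cases h with
    | head _ _ h => exact .inl h
    | tail _ h => exact .inr ⟨rfl, h⟩
  · rintro (h | ⟨rfl, h⟩)
    · exact .head _ _ h
    · exact .tail _ h

theorem PosLT.irrefl (v : List ℕ) : ¬ PosLT v v := by
  induction v with
  | nil => exact not_nil_left
  | cons i v ih => simp [cons_cons, ih]

theorem PosLT.trans {u v w : List ℕ} (h : PosLT u v) (h' : PosLT v w) : PosLT u w := by
  induction h generalizing w with
  | nil i v => exact absurd h' not_nil_left
  | head v w h =>
    cases h' with
    | nil => exact .nil _ _
    | head _ _ h2 => exact .head _ _ (h.trans h2)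
    | tail _ h2 => exact .head _ _ h
  | tail i h ih =>
    cases h' with
    | nil => exact .nil _ _
    | head _ _ h2 => exact .head _ _ h2
    | tail _ h2 => exact .tail _ (ih h2)

theorem PosLT.trichotomy (v w : List ℕ) : PosLT v w ∨ v = w ∨ PosLT w v := by
  induction v generalizing w with
  | nil =>
    cases w with
    | nil => exact .inr (.inl rfl)
    | cons j w => exact .inr (.inr (.nil _ _))
  | cons i v ih =>
    cases w with
    | nil => exact .inl (.nil _ _)
    | cons j w =>
      rcases lt_trichotomy i j with h | rfl | h
      · exact .inl (.head _ _ h)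
      · rcases ih w with h | rfl | h
        · exact .inl (.tail _ h)
        · exact .inr (.inl rfl)
        · exact .inr (.inr (.tail _ h))
      · exact .inr (.inr (.head _ _ h))

/-- Two lists with the same members whose positions are strictly increasing are equal. -/
theorem PosLT.list_ext {α : Type*} {d d' : List (α × List ℕ)}
    (h : d.Pairwise (fun a b => PosLT a.2 b.2)) (h' : d'.Pairwise (fun a b => PosLT a.2 b.2))
    (hm : ∀ a, a ∈ d ↔ a ∈ d') : d = d' := by
  have nd : ∀ {l : List (α × List ℕ)}, l.Pairwise (fun a b => PosLT a.2 b.2) → l.Nodup :=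
    fun hl => List.Pairwise.imp (fun {a b} hab (e : a = b) => PosLT.irrefl b.2 (e ▸ hab)) hl
  refine List.Perm.eq_of_pairwise (le := fun a b => PosLT a.2 b.2) ?_ h h'
    ((List.perm_ext_iff_of_nodup (nd h) (nd h')).2 hm)
  intro a b _ _ hab hba
  exact absurd (hab.trans hba) (PosLT.irrefl _)

/-! ### Subtrees and replacement. -/

namespace RankedTree

variable {S : Type*} {rk : S → ℕ} {Z : Type*}

@[simp] theorem subtree?_nil (t : RankedTree rk Z) : t.subtree? [] = some t := by
  cases t <;> rfl

@[simp] theorem subtree?_leaf_cons (z : Z) (i : ℕ) (w : List ℕ) :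
    (leaf z : RankedTree rk Z).subtree? (i :: w) = none := rfl

@[simp] theorem subtree?_node_cons (s : S) (ts : Fin (rk s) → RankedTree rk Z)
    (i : Fin (rk s)) (w : List ℕ) :
    (node s ts).subtree? (i :: w) = (ts i).subtree? w := by
  simp [subtree?]

@[simp] theorem replace_nil (t r : RankedTree rk Z) : t.replace [] r = r := by
  cases t <;> rfl

theorem replace_node_cons (s : S) (ts : Fin (rk s) → RankedTree rk Z) (i : Fin (rk s))
    (w : List ℕ) (r : RankedTree rk Z) :
    (node s ts).replace (i :: w) r = node s (Function.update ts i ((ts i).replace w r)) := by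
  rw [replace]
  congr 1
  funext j
  by_cases h : j = i
  · subst h; simp
  · have : (j : ℕ) ≠ i := fun e => h (Fin.ext e)
    simp [h, this]

theorem exists_of_subtree?_node_cons {s : S} {ts : Fin (rk s) → RankedTree rk Z} {i : ℕ}
    {w : List ℕ} {r : RankedTree rk Z} (h : (node s ts).subtree? (i :: w) = some r) :
    ∃ j : Fin (rk s), i = j ∧ (ts j).subtree? w = some r := by
  rw [subtree?] at h
  split at h
  · exact ⟨⟨i, ‹_›⟩, rfl, h⟩
  · cases h

theorem subtree?_append {t r : RankedTree rk Z} {v w : List ℕ} (h : t.subtree? v = some r) :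
    t.subtree? (v ++ w) = r.subtree? w := by
  induction v generalizing t with
  | nil => simp at h; subst h; rfl
  | cons i v ih =>
    cases t with
    | leaf z => cases h
    | node s ts =>
      obtain ⟨j, rfl, hj⟩ := exists_of_subtree?_node_cons h
      simpa using ih hj

end RankedTree

open RankedTree

/-! ### Decomposition of derivations and the recurrences for their weights. -/

namespace WTGc

variable {S : Type*} {rk : S → ℕ} {Q : Type*} (G : WTGc rk Q)

/-- Prepend `i` to the position of a derivation step. -/
def shift (i : ℕ) (a : Production rk Q × List ℕ) : Production rk Q × List ℕ := (a.1, i :: a.2)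

/-- Remove the first letter from the position of a derivation step, if it is `i`. -/
def unshift (i : ℕ) : Production rk Q × List ℕ → Option (Production rk Q × List ℕ)
  | (_, []) => none
  | (p, j :: v) => if j = i then some (p, v) else none

theorem unshift_eq_some {i : ℕ} {a b : Production rk Q × List ℕ} :
    unshift i a = some b ↔ a = shift i b := by
  obtain ⟨p, _ | ⟨j, v⟩⟩ := a <;> obtain ⟨p', v'⟩ := b
  · simp [unshift, shift]
  · simp only [unshift, shift]
    split <;> simp_all

theorem mem_filterMap_unshift {i : ℕ} {b : Production rk Q × List ℕ}
    {d : List (Production rk Q × List ℕ)} : b ∈ d.filterMap (unshift i) ↔ shift i b ∈ d := by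
  simp [List.mem_filterMap, unshift_eq_some]

/-- The left-most derivations for the input tree `t` from `t` to the tree `l`. -/
def treeDerivations (t : RankedTree rk Empty) (l : RankedTree rk Q) :
    Set (List (Production rk Q × List ℕ)) :=
  {d | G.Derives t t.embed d l ∧ d.Pairwise (fun a b => PosLT a.2 b.2)}

/-- The sum of the weights of all left-most derivations for `t` from `t` to `l`. -/
noncomputable def treeWt (t : RankedTree rk Empty) (l : RankedTree rk Q) : ℕ :=
  ∑ᶠ d ∈ G.treeDerivations t l, G.derivWt d

theorem stateWt_eq_treeWt (q : Q) (t : RankedTree rk Empty) :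
    G.stateWt q t = G.treeWt t (leaf q) := rfl

variable {G}

theorem Derives.append {t : RankedTree rk Empty} {ξ ζ χ : RankedTree rk Q}
    {d e : List (Production rk Q × List ℕ)} (h : G.Derives t ξ d ζ) (h' : G.Derives t ζ e χ) :
    G.Derives t ξ (d ++ e) χ := by
  induction h with
  | nil _ => exact h'
  | cons hs _ ih => exact .cons hs (ih h')

theorem Derives.eq_of_leaf {t : RankedTree rk Empty} {q : Q} {ζ : RankedTree rk Q}
    {d : List (Production rk Q × List ℕ)} (h : G.Derives t (leaf q) d ζ) :
    d = [] ∧ ζ = leaf q := by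
  cases h with
  | nil _ => exact ⟨rfl, rfl⟩
  | @cons _ _ _ p w _ hs _ =>
    exfalso
    cases w with
    | nil =>
      have h1 := hs.2.1
      simp at h1
      exact G.lhs_not_state _ hs.1 _ h1.symm
    | cons i w => cases hs.2.1

theorem Derives.shift {s : S} {ts : Fin (rk s) → RankedTree rk Empty} {i : Fin (rk s)}
    {ξ ζ : RankedTree rk Q} {d : List (Production rk Q × List ℕ)} (h : G.Derives (ts i) ξ d ζ)
    (ξs : Fin (rk s) → RankedTree rk Q) (hξ : ξs i = ξ) :
    G.Derives (node s ts) (node s ξs) (d.map (WTGc.shift i)) (node s (Function.update ξs i ζ)) := by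
  induction h generalizing ξs with
  | nil ξ =>
    subst hξ
    rw [Function.update_eq_self]
    exact .nil _
  | @cons ξ ζ χ p w d hs _ ih =>
    subst hξ
    obtain ⟨hp, h1, rfl, r, hr, hE⟩ := hs
    have := ih (Function.update ξs i ((ξs i).replace w (leaf p.tgt))) (by simp)
    rw [Function.update_idem] at this
    refine .cons ⟨hp, by simpa using h1, ?_, r, by simpa using hr, hE⟩ this
    exact (replace_node_cons ..).symm

/-- A step at the root produces a bare state, from which no further step is possible. A derivation
that ends in a node therefore works strictly below the root, and its steps can be sorted by direct
subtree. -/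
theorem Derives.unshift {s : S} {ts : Fin (rk s) → RankedTree rk Empty} {ξ ζ : RankedTree rk Q}
    {d : List (Production rk Q × List ℕ)} (h : G.Derives (node s ts) ξ d ζ)
    (ξs : Fin (rk s) → RankedTree rk Q) (hξ : ξ = node s ξs) :
    (∃ q, ζ = leaf q) ∨ ∃ ls, ζ = node s ls ∧
      (∀ a ∈ d, ∃ i : Fin (rk s), ∃ b, a = WTGc.shift i b) ∧
      ∀ i : Fin (rk s), G.Derives (ts i) (ξs i) (d.filterMap (WTGc.unshift i)) (ls i) := by
  induction h generalizing ξs with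
  | nil ξ => exact .inr ⟨ξs, hξ, by simp, fun i => .nil _⟩
  | @cons ξ ζ χ p w d hs hd ih =>
    subst hξ
    obtain ⟨hp, h1, rfl, r, hr, hE⟩ := hs
    cases w with
    | nil =>
      rw [replace_nil] at hd
      exact .inl ⟨_, hd.eq_of_leaf.2⟩
    | cons j w =>
      obtain ⟨j, rfl, hj⟩ := exists_of_subtree?_node_cons h1
      rcases ih _ (replace_node_cons ..) with h | ⟨ls, rfl, hm, h⟩
      · exact .inl h
      refine .inr ⟨ls, rfl, ?_, fun i => ?_⟩
      · rintro a ha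
        rcases List.mem_cons.1 ha with rfl | ha
        · exact ⟨j, (p, w), rfl⟩
        · exact hm a ha
      · have hi := h i
        by_cases hij : i = j
        · subst hij
          rw [Function.update_self] at hi
          rw [List.filterMap_cons_some (b := (p, w)) (by simp [WTGc.unshift])]
          exact .cons ⟨hp, hj, rfl, r, by simpa using hr, hE⟩ hi
        · rw [Function.update_of_ne hij] at hi
          rw [List.filterMap_cons_none]
          · exact hi
          · have : (j : ℕ) ≠ i := fun e => hij (Fin.ext e.symm)
            simp [WTGc.unshift, this]

theorem Derives.exists_last {t : RankedTree rk Empty} {ξ : RankedTree rk Q} {q : Q}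
    {d : List (Production rk Q × List ℕ)} (h : G.Derives t ξ d (leaf q)) (hξ : ξ ≠ leaf q) :
    ∃ d' p, d = d' ++ [(p, [])] ∧ G.Derives t ξ d' p.lhs ∧ p ∈ G.prods ∧ p.tgt = q ∧
      t.Satisfies p.eqs := by
  generalize hζ : leaf q = ζ at h
  induction h with
  | nil ξ => exact absurd hζ.symm hξ
  | @cons ξ ζ χ p w d hs hd ih =>
    subst hζ
    by_cases hz : ζ = leaf q
    · subst hz
      obtain ⟨rfl, -⟩ := hd.eq_of_leaf
      obtain ⟨hp, h1, h2, r, hr, hE⟩ := hs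
      cases w with
      | nil =>
        simp only [subtree?_nil, Option.some.injEq, replace_nil, leaf.injEq] at h1 h2 hr
        subst h1 h2 hr
        exact ⟨[], p, rfl, .nil _, hp, rfl, hE⟩
      -- A step below the root keeps the root symbol, so it cannot produce a state.
      | cons i w =>
        cases ξ with
        | leaf z => cases h1
        | node s ts => simp [replace] at h2
    · obtain ⟨d', p', rfl, h2, h3⟩ := ih hz rfl
      exact ⟨(p, w) :: d', p', rfl, .cons hs h2, h3⟩

theorem embed_ne_leaf (t : RankedTree rk Empty) (q : Q) : t.embed ≠ leaf q := by
  cases t with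
  | leaf z => exact z.elim
  | node s ts => simp [embed]

/-- The step that produces the state at the root must come last, and the empty position is the
largest one, so appending it preserves the left-most order. -/
theorem treeDerivations_leaf (t : RankedTree rk Empty) (q : Q) :
    G.treeDerivations t (leaf q) = ⋃ p ∈ {p | p ∈ G.prods ∧ p.tgt = q ∧ t.Satisfies p.eqs},
      (fun d => d ++ [(p, [])]) '' G.treeDerivations t p.lhs := by
  ext d
  simp only [Set.mem_iUnion, Set.mem_image, Set.mem_ofPred_eq, exists_prop, treeDerivations]
  constructor
  · rintro ⟨h, hd⟩
    obtain ⟨d', p, rfl, h1, h2⟩ := h.exists_last (embed_ne_leaf t q)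
    exact ⟨p, h2, d', ⟨h1, (List.pairwise_append.1 hd).1⟩, rfl⟩
  · rintro ⟨p, ⟨hp, rfl, hE⟩, d', ⟨h1, h2⟩, rfl⟩
    refine ⟨h1.append (.cons ⟨hp, subtree?_nil _, by simp, t, subtree?_nil _, hE⟩ (.nil _)), ?_⟩
    refine List.pairwise_append.2 ⟨h2, List.pairwise_singleton .., ?_⟩
    rintro a ha b hb
    obtain rfl := List.mem_singleton.1 hb
    obtain ⟨p', _ | ⟨i, w⟩⟩ := a
    -- An earlier step at the root would leave a state there for good, but the left-hand side of `p`
    -- is not a state.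
    · exfalso
      clear h2
      generalize t.embed = ξ at h1
      obtain ⟨l, hl⟩ : ∃ l, p.lhs = l := ⟨_, rfl⟩
      have hne := G.lhs_not_state p hp
      rw [hl] at h1 hne
      clear hl
      induction h1 with
      | nil => cases ha
      | cons hs hd ih =>
        rcases List.mem_cons.1 ha with h | h
        · cases h
          obtain ⟨_, _, rfl, _⟩ := hs
          rw [replace_nil] at hd
          exact hne _ hd.eq_of_leaf.2
        · exact ih h hne
    · exact .nil _ _

/-- Concatenation of derivations for the direct subtrees. -/
def joinDerivs {n : ℕ} (f : Fin n → List (Production rk Q × List ℕ)) :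
    List (Production rk Q × List ℕ) :=
  (List.finRange n).flatMap (fun i => (f i).map (shift i))

theorem mem_joinDerivs {n : ℕ} {f : Fin n → List (Production rk Q × List ℕ)} {i : Fin n}
    {b : Production rk Q × List ℕ} : shift i b ∈ joinDerivs f ↔ b ∈ f i := by
  simp only [joinDerivs, List.mem_flatMap, List.mem_finRange, true_and, List.mem_map]
  constructor
  · rintro ⟨j, c, hc, h⟩
    simp only [shift, Prod.mk.injEq, List.cons.injEq] at h
    obtain ⟨h1, h2, h3⟩ := h
    obtain rfl := Fin.ext h2
    obtain rfl := Prod.ext h1 h3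
    exact hc
  · exact fun h => ⟨i, b, h, rfl⟩

theorem pairwise_joinDerivs {n : ℕ} {f : Fin n → List (Production rk Q × List ℕ)}
    (hf : ∀ i, (f i).Pairwise (fun a b => PosLT a.2 b.2)) :
    (joinDerivs f).Pairwise (fun a b => PosLT a.2 b.2) := by
  refine List.pairwise_flatMap.2 ⟨fun i _ => ?_, ?_⟩
  · exact List.pairwise_map.2 ((hf i).imp (fun h => .tail _ h))
  · refine (List.pairwise_lt_finRange n).imp ?_
    intro i j hij a ha b hb
    obtain ⟨a, -, rfl⟩ := List.mem_map.1 ha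
    obtain ⟨b, -, rfl⟩ := List.mem_map.1 hb
    exact .head _ _ hij

theorem pairwise_unshift {d : List (Production rk Q × List ℕ)}
    (hd : d.Pairwise (fun a b => PosLT a.2 b.2)) (i : ℕ) :
    (d.filterMap (unshift i)).Pairwise (fun a b => PosLT a.2 b.2) := by
  refine List.pairwise_filterMap.2 (hd.imp ?_)
  intro a b hab a' ha b' hb
  rw [unshift_eq_some] at ha hb
  subst ha hb
  simpa [shift, PosLT.cons_cons] using hab

theorem filterMap_joinDerivs {n : ℕ} (f : Fin n → List (Production rk Q × List ℕ))
    (i : Fin n) : (joinDerivs f).filterMap (unshift i) = f i := by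
  have key : ∀ L : List (Fin n), L.Nodup →
      (L.flatMap (fun i => (f i).map (shift i))).filterMap (unshift i) =
        if i ∈ L then f i else [] := by
    intro L hL
    induction L with
    | nil => simp
    | cons j L ih =>
      rw [List.nodup_cons] at hL
      rw [List.flatMap_cons, List.filterMap_append, ih hL.2, List.filterMap_map]
      by_cases hij : i = j
      · subst hij
        have : unshift (rk := rk) (Q := Q) i ∘ shift i = some := by
          funext b; exact unshift_eq_some.2 rfl
        simp only [this]
        simp [hL.1]
      · have : unshift (rk := rk) (Q := Q) i ∘ shift j = fun _ => none := by
          funext b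
          have : (j : ℕ) ≠ i := fun e => hij (Fin.ext e.symm)
          simp [unshift, shift, this]
        simp only [this]
        simp [hij]
  simpa [joinDerivs] using key _ (List.nodup_finRange n)

theorem joinDerivs_injective {n : ℕ} :
    Function.Injective (joinDerivs (rk := rk) (Q := Q) (n := n)) := by
  intro f g h
  funext i
  rw [← filterMap_joinDerivs f, h, filterMap_joinDerivs]

theorem derivWt_joinDerivs {n : ℕ} (f : Fin n → List (Production rk Q × List ℕ)) :
    G.derivWt (joinDerivs f) = ∏ i, G.derivWt (f i) := by
  have key : ∀ L : List (Fin n), G.derivWt (L.flatMap (fun i => (f i).map (shift i))) =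
      (L.map (fun i => G.derivWt (f i))).prod := by
    intro L
    induction L with
    | nil => rfl
    | cons j L ih =>
      rw [List.map_cons, List.prod_cons, ← ih]
      simp [derivWt, Function.comp_def, shift]
  rw [joinDerivs, key, ← List.ofFn_eq_map, List.prod_ofFn]

theorem derives_joinDerivs {s : S} {ts : Fin (rk s) → RankedTree rk Empty}
    {ξs ls : Fin (rk s) → RankedTree rk Q} {f : Fin (rk s) → List (Production rk Q × List ℕ)}
    (h : ∀ i, G.Derives (ts i) (ξs i) (f i) (ls i)) :
    G.Derives (node s ts) (node s ξs) (joinDerivs f) (node s ls) := by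
  -- `L` lists the subtrees still to be processed; the others have already reached their targets.
  have key : ∀ L : List (Fin (rk s)), L.Nodup → ∀ ζs : Fin (rk s) → RankedTree rk Q,
      (∀ i ∈ L, ζs i = ξs i) → (∀ i ∉ L, ζs i = ls i) →
      G.Derives (node s ts) (node s ζs) (L.flatMap (fun i => (f i).map (WTGc.shift i)))
        (node s ls) := by
    intro L hL
    induction L with
    | nil =>
      intro ζs _ h2
      obtain rfl : ζs = ls := funext fun i => h2 i (by simp)
      exact .nil _
    | cons j L ih =>
      intro ζs h1 h2
      rw [List.nodup_cons] at hL
      rw [List.flatMap_cons]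
      refine ((h j).shift ζs (h1 j (by simp))).append (ih hL.2 _ ?_ ?_)
      · intro i hi
        have : i ≠ j := fun e => hL.1 (e ▸ hi)
        rw [Function.update_of_ne this]
        exact h1 i (by simp [hi])
      · intro i hi
        by_cases hij : i = j
        · subst hij; simp
        · rw [Function.update_of_ne hij]
          exact h2 i (by simp [hi, hij])
  exact key _ (List.nodup_finRange _) ξs (fun _ _ => rfl) (fun i hi => by simp at hi)

/-- Steps in different subtrees do not interact, and the left-most order admits exactly one
interleaving: the subtrees from left to right. -/
theorem treeDerivations_node (s : S) (ts : Fin (rk s) → RankedTree rk Empty)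
    (ls : Fin (rk s) → RankedTree rk Q) :
    G.treeDerivations (node s ts) (node s ls) =
      joinDerivs '' Set.univ.pi (fun i => G.treeDerivations (ts i) (ls i)) := by
  ext d
  simp only [Set.mem_image, Set.mem_univ_pi]
  constructor
  · rintro ⟨h, hd⟩
    rcases h.unshift (fun i => (ts i).embed) rfl with ⟨q, hq⟩ | ⟨ls', h1, hm, h2⟩
    · cases hq
    cases h1
    refine ⟨fun i => d.filterMap (unshift i), fun i => ⟨h2 i, pairwise_unshift hd i⟩, ?_⟩
    refine PosLT.list_ext (pairwise_joinDerivs fun i => pairwise_unshift hd i) hd fun a => ?_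
    constructor
    · intro ha
      obtain ⟨i, -, hi⟩ := List.mem_flatMap.1 ha
      obtain ⟨b, hb, rfl⟩ := List.mem_map.1 hi
      exact mem_filterMap_unshift.1 hb
    · intro ha
      obtain ⟨i, b, rfl⟩ := hm a ha
      exact mem_joinDerivs.2 (mem_filterMap_unshift.2 ha)
  · rintro ⟨f, hf, rfl⟩
    exact ⟨derives_joinDerivs fun i => (hf i).1, pairwise_joinDerivs fun i => (hf i).2⟩

theorem treeDerivations_node_of_ne {s s' : S} (h : s ≠ s')
    (ts : Fin (rk s) → RankedTree rk Empty) (ls : Fin (rk s') → RankedTree rk Q) :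
    G.treeDerivations (node s ts) (node s' ls) = ∅ := by
  refine Set.eq_empty_of_forall_notMem fun d hd => ?_
  rcases hd.1.unshift (fun i => (ts i).embed) rfl with ⟨q, hq⟩ | ⟨ls', h1, -⟩
  · cases hq
  · cases h1
    exact h rfl

/-- Needed because `finsum` takes the value 0 on infinite supports. A state target reduces to
left-hand sides for the same `t`; these are nodes, so the induction passes to the direct subtrees of
`t`. -/
theorem finite_treeDerivations (t : RankedTree rk Empty) (l : RankedTree rk Q) :
    (G.treeDerivations t l).Finite := by
  induction t generalizing l with
  | leaf z => exact z.elim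
  | node s ts ih =>
    have hn : ∀ s' (ls : Fin (rk s') → RankedTree rk Q),
        (G.treeDerivations (node s ts) (node s' ls)).Finite := by
      intro s' ls
      by_cases h : s = s'
      · subst h
        rw [treeDerivations_node]
        exact (Set.Finite.pi fun i => ih i (ls i)).image _
      · rw [treeDerivations_node_of_ne h]
        exact Set.finite_empty
    cases l with
    | node s' ls => exact hn s' ls
    | leaf q =>
      rw [treeDerivations_leaf]
      refine Set.Finite.biUnion (G.prods.finite_toSet.subset fun p hp => hp.1) fun p hp => ?_
      refine Set.Finite.image _ ?_
      rcases hl : p.lhs with z | ⟨s', ls⟩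
      · exact absurd hl (G.lhs_not_state p hp.1 z)
      · exact hn s' ls

theorem treeWt_node_of_ne {s s' : S} (h : s ≠ s') (ts : Fin (rk s) → RankedTree rk Empty)
    (ls : Fin (rk s') → RankedTree rk Q) : G.treeWt (node s ts) (node s' ls) = 0 := by
  rw [treeWt, treeDerivations_node_of_ne h, finsum_mem_empty]

theorem treeWt_node (s : S) (ts : Fin (rk s) → RankedTree rk Empty)
    (ls : Fin (rk s) → RankedTree rk Q) :
    G.treeWt (node s ts) (node s ls) = ∏ i, G.treeWt (ts i) (ls i) := by
  classical
  rw [treeWt, treeDerivations_node, finsum_mem_image joinDerivs_injective.injOn]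
  have hfin := fun i => finite_treeDerivations (G := G) (ts i) (ls i)
  simp only [treeWt, derivWt_joinDerivs]
  have h1 : ∀ i, ∑ᶠ d ∈ G.treeDerivations (ts i) (ls i), G.derivWt d =
      ∑ d ∈ (hfin i).toFinset, G.derivWt d := fun i => finsum_mem_eq_finite_toFinset_sum _ (hfin i)
  simp only [h1]
  rw [Finset.prod_univ_sum, ← finsum_mem_coe_finset]
  simp

open scoped Classical in
theorem treeWt_leaf (t : RankedTree rk Empty) (q : Q) :
    G.treeWt t (leaf q) = ∑ p ∈ G.prods with p.tgt = q ∧ t.Satisfies p.eqs,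
      G.wt p * G.treeWt t p.lhs := by
  have hfin : {p | p ∈ G.prods ∧ p.tgt = q ∧ t.Satisfies p.eqs}.Finite :=
    G.prods.finite_toSet.subset fun p hp => hp.1
  rw [treeWt, treeDerivations_leaf, finsum_mem_biUnion _ hfin
    fun p _ => (finite_treeDerivations t p.lhs).image _]
  · rw [← finsum_mem_coe_finset]
    have : {p | p ∈ G.prods ∧ p.tgt = q ∧ t.Satisfies p.eqs} =
      ↑(G.prods.filter fun p => p.tgt = q ∧ t.Satisfies p.eqs) := by ext; simp
    rw [this]
    refine finsum_mem_congr rfl fun p _ => ?_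
    rw [finsum_mem_image (fun a _ b _ h => List.append_cancel_right h), treeWt,
      finsum_mem_eq_finite_toFinset_sum _ (finite_treeDerivations t p.lhs),
      finsum_mem_eq_finite_toFinset_sum _ (finite_treeDerivations t p.lhs), Finset.mul_sum]
    refine Finset.sum_congr rfl fun d _ => ?_
    simp [derivWt, mul_comm]
  -- The last step of a derivation determines the production, so the pieces are disjoint.
  · intro p _ p' _ hne
    refine Set.disjoint_left.2 ?_
    rintro _ ⟨d, _, rfl⟩ ⟨d', _, h⟩
    have := List.append_inj_right' h rfl
    simp at this
    exact hne this.symm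

theorem sem_eq [Fintype Q] (t : RankedTree rk Empty) :
    G.sem t = ∑ q, G.final q * G.treeWt t (leaf q) := by
  refine Finset.sum_congr rfl fun q _ => ?_
  have hfin := finite_treeDerivations (G := G) t (leaf q)
  rw [treeWt, finsum_mem_eq_finite_toFinset_sum _ hfin, Finset.mul_sum]
  exact finsum_mem_eq_finite_toFinset_sum _ hfin

end WTGc

/-! ### Weights of left-hand sides with trees filled in. -/

theorem PosLT.exists_least (s : Finset (List ℕ)) (hs : s.Nonempty) :
    ∃ m ∈ s, ∀ x ∈ s, x = m ∨ PosLT m x := by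
  induction hs using Finset.Nonempty.cons_induction with
  | singleton a => exact ⟨a, by simp, fun x hx => .inl (by simpa using hx)⟩
  | cons a s ha hs ih =>
    obtain ⟨m, hm, h⟩ := ih
    rcases PosLT.trichotomy a m with h1 | rfl | h1
    · refine ⟨a, by simp, fun x hx => ?_⟩
      rcases Finset.mem_cons.1 hx with rfl | hx
      · exact .inl rfl
      · rcases h x hx with rfl | h2
        · exact .inr h1
        · exact .inr (h1.trans h2)
    · exact absurd hm ha
    · refine ⟨m, by simp [hm], fun x hx => ?_⟩
      rcases Finset.mem_cons.1 hx with rfl | hx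
      · exact .inr h1
      · exact h x hx

namespace WTGc

variable {S : Type*} {rk : S → ℕ} {Q : Type*} {G : WTGc rk Q}

open scoped Classical in
-- A tree without states is reached only from itself, by the empty derivation; nullary symbols give
-- empty products in the recursion.
theorem treeWt_embed (t t' : RankedTree rk Empty) :
    G.treeWt t t'.embed = if t = t' then 1 else 0 := by
  induction t generalizing t' with
  | leaf z => exact z.elim
  | node s ts ih =>
    cases t' with
    | leaf z => exact z.elim
    | node s' ts' =>
      rw [embed]
      by_cases h : s = s'
      · subst h
        simp only [treeWt_node, ih, Finset.prod_ite_zero, Finset.prod_const_one, node.injEq,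
          heq_eq_eq, true_and, funext_iff, Finset.mem_univ, forall_const]
      · rw [treeWt_node_of_ne h, if_neg]
        intro e
        cases e
        exact h rfl

theorem derivations_nonempty_of_treeWt_ne_zero {t : RankedTree rk Empty} {q : Q}
    (h : G.treeWt t (leaf q) ≠ 0) : (G.derivations q t).Nonempty := by
  by_contra hne
  rw [Set.not_nonempty_iff_eq_empty] at hne
  exact h (by rw [← stateWt_eq_treeWt, stateWt, hne, finsum_mem_empty])

theorem exists_subtree?_of_treeWt_ne_zero {t : RankedTree rk Empty} {l : RankedTree rk Q}
    (h : G.treeWt t l ≠ 0) {w : List ℕ} {q : Q} (hw : l.subtree? w = some (leaf q)) :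
    ∃ t', t.subtree? w = some t' ∧ G.treeWt t' (leaf q) ≠ 0 := by
  induction l generalizing t w with
  | leaf z =>
    cases w with
    | nil =>
      simp only [subtree?_nil, Option.some.injEq, leaf.injEq] at hw
      subst hw
      exact ⟨t, subtree?_nil t, h⟩
    | cons i w => cases hw
  | node s ls ih =>
    cases w with
    | nil => simp at hw
    | cons i w =>
      obtain ⟨j, rfl, hj⟩ := exists_of_subtree?_node_cons hw
      cases t with
      | leaf z => exact z.elim
      | node s' ts =>
        by_cases hs : s' = s
        · subst hs
          rw [treeWt_node] at h
          simpa using ih j (Finset.prod_ne_zero_iff.1 h j (Finset.mem_univ j)) hj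
        · exact absurd (treeWt_node_of_ne hs ts ls) h

/-- The factor that a choice `t` for a position labelled `q` contributes to the weight of a
production of the linearization. -/
noncomputable def linFactor (G : WTGc rk Q) :
    Option (RankedTree rk Q) → Option (RankedTree rk Empty) → ℕ
  | some (.leaf q), some t => G.stateWt q t
  | _, _ => 1

theorem linWt_eq (p : Production rk Q) (θ : List ℕ → Option (RankedTree rk Empty)) :
    G.linWt p θ = G.wt p * ∏ w ∈ p.constrained, G.linFactor (p.lhs.subtree? w) (θ w) := by
  rw [linWt]
  refine congrArg _ (Finset.prod_congr rfl fun w _ => ?_)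
  rcases p.lhs.subtree? w with _ | ⟨_ | _⟩ <;> rcases θ w with _ | _ <;> rfl

open scoped Classical in
-- Both sides factor over the leaves of `l`. At a filled leaf the `H`-weight is 1 or 0 according to
-- whether the chosen tree is the subtree of `t`, and `linFactor` restores the `G`-weight; at any
-- other state leaf `hH` applies.
theorem prod_linFactor_mul_treeWt_fill (H : WTGc rk Q) (l : RankedTree rk Q)
    (C : Finset (List ℕ)) (hC : ∀ w ∈ C, ∃ q, l.subtree? w = some (leaf q))
    (θ : List ℕ → Option (RankedTree rk Empty)) (hθ : ∀ w, (θ w).isSome ↔ w ∈ C)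
    (t : RankedTree rk Empty)
    (hH : ∀ w q t', l.subtree? w = some (leaf q) → t.subtree? w = some t' →
      H.treeWt t' (leaf q) = G.treeWt t' (leaf q)) :
    (∏ w ∈ C, G.linFactor (l.subtree? w) (θ w)) *
        H.treeWt t (l.fill fun w => (θ w).map RankedTree.embed) =
      if ∀ w ∈ C, θ w = t.subtree? w then G.treeWt t l else 0 := by
  induction l generalizing C θ t with
  | leaf q =>
    have hC' : ∀ w ∈ C, w = [] := by
      intro w hw
      obtain ⟨q', h⟩ := hC w hw
      cases w with
      | nil => rfl
      | cons i w => cases h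
    rw [fill]
    rcases h0 : θ [] with _ | t'
    · obtain rfl : C = ∅ := by
        refine Finset.eq_empty_of_forall_notMem fun w hw => ?_
        obtain rfl := hC' w hw
        simpa [h0] using (hθ []).2 hw
      simpa using hH [] q t (subtree?_nil _) (subtree?_nil _)
    · obtain rfl : C = {[]} := by
        refine Finset.eq_singleton_iff_unique_mem.2 ⟨(hθ []).1 (by simp [h0]), hC'⟩
      simp only [Finset.prod_singleton, h0, subtree?_nil, Option.map_some, Option.getD_some,
        treeWt_embed, Finset.mem_singleton, forall_eq, Option.some.injEq, linFactor,
        stateWt_eq_treeWt]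
      by_cases h : t = t'
      · subst h; simp
      · simp [h, Ne.symm h]
  | node s ls ih =>
    cases t with
    | leaf z => exact z.elim
    | node s' ts =>
      rw [fill]
      by_cases hs : s' = s
      swap
      · rw [treeWt_node_of_ne hs, treeWt_node_of_ne hs]
        simp
      subst hs
      -- The positions of `C` inside the direct subtree `i`, with the leading `i` removed.
      let D : Fin (rk s') → Finset (List ℕ) := fun i =>
        C.preimage (List.cons (i : ℕ)) (List.cons_injective.injOn)
      have hD : ∀ i w, w ∈ D i ↔ (i : ℕ) :: w ∈ C := fun i w => Finset.mem_preimage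
      have hCD : C = Finset.univ.biUnion fun i => (D i).image (List.cons (i : ℕ)) := by
        ext w
        simp only [Finset.mem_biUnion, Finset.mem_univ, true_and, Finset.mem_image, hD]
        constructor
        · intro hw
          obtain ⟨q, hq⟩ := hC w hw
          cases w with
          | nil => simp at hq
          | cons i w =>
            obtain ⟨j, rfl, -⟩ := exists_of_subtree?_node_cons hq
            exact ⟨j, w, hw, rfl⟩
        · rintro ⟨i, w, hw, rfl⟩
          exact hw
      have hdisj : (↑(Finset.univ : Finset (Fin (rk s'))) : Set (Fin (rk s'))).PairwiseDisjoint
          fun i => (D i).image (List.cons (i : ℕ)) := by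
        intro i _ j _ hij
        refine Finset.disjoint_left.2 fun w hw hw' => hij ?_
        obtain ⟨v, -, rfl⟩ := Finset.mem_image.1 hw
        obtain ⟨v', -, h⟩ := Finset.mem_image.1 hw'
        exact Fin.ext (List.cons.inj h).1.symm
      have hprod : ∏ w ∈ C, G.linFactor ((node s' ls).subtree? w) (θ w) =
          ∏ i, ∏ w ∈ D i, G.linFactor ((ls i).subtree? w) (θ (i :: w)) := by
        rw [hCD, Finset.prod_biUnion hdisj]
        refine Finset.prod_congr rfl fun i _ => ?_
        rw [Finset.prod_image (List.cons_injective.injOn)]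
        simp
      have hcond : (∀ w ∈ C, θ w = (node s' ts).subtree? w) ↔
          ∀ i, ∀ w ∈ D i, θ (i :: w) = (ts i).subtree? w := by
        constructor
        · intro h i w hw
          simpa using h _ ((hD i w).1 hw)
        · intro h w hw
          rw [hCD] at hw
          simp only [Finset.mem_biUnion, Finset.mem_univ, true_and, Finset.mem_image] at hw
          obtain ⟨i, w, hw, rfl⟩ := hw
          simpa using h i w hw
      rw [hprod, treeWt_node, ← Finset.prod_mul_distrib, treeWt_node]
      simp only [hcond]
      rw [Finset.prod_congr rfl fun i _ => ih i (D i) ?_ (fun w => θ (i :: w)) ?_ (ts i) ?_]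
      · rw [Finset.prod_ite_zero]
        simp
      · intro w hw
        simpa using hC _ ((hD i w).1 hw)
      · intro w
        rw [hθ, hD]
      · intro w q t' h1 h2
        exact hH (i :: w) q t' (by simpa using h1) (by simpa using h2)

theorem mem_constrained {p : Production rk Q} {w : List ℕ} :
    w ∈ p.constrained ↔ ∃ v, (w, v) ∈ p.eqs ∧ w ≠ v := by
  simp [Production.constrained]

end WTGc

/-! ### Constraints versus admissible choices. -/

namespace WTGh

variable {S : Type*} {rk : S → ℕ} {Q : Type*} {G : WTGh rk Q}

/-- A tree at a constrained position is small if there is no large duplication. -/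
theorem height_le_of_not_largeDuplication [Fintype Q] (hL : ¬ G.LargeDuplication)
    {p : Production rk Q} (hp : p ∈ G.prods) {t : RankedTree rk Empty} (ht : t.Satisfies p.eqs)
    (hW : G.treeWt t p.lhs ≠ 0) {u : List ℕ} (hu : u ∈ p.constrained) {r : RankedTree rk Empty}
    (hr : t.subtree? u = some r) : r.height ≤ G.height := by
  classical
  obtain ⟨v, huv, hne⟩ := WTGc.mem_constrained.1 hu
  have huu := G.eqs_trans p hp _ _ _ huv (G.eqs_symm p hp _ _ huv)
  -- `m` is the least position in the class of `u`.
  obtain ⟨m, hm, hmin⟩ := PosLT.exists_least ((p.eqs.filter (fun e => e.1 = u)).image Prod.snd)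
    ⟨v, by simpa using huv⟩
  have hum : (u, m) ∈ p.eqs := by simpa using hm
  have hmu := G.eqs_symm p hp _ _ hum
  -- A second member of the class, which is then labelled ⊥ and forces the label of `m` to be
  -- different from ⊥.
  obtain ⟨x, hmx, hxm⟩ : ∃ x, (m, x) ∈ p.eqs ∧ x ≠ m := by
    by_cases h : u = m
    · subst h
      exact ⟨v, huv, hne.symm⟩
    · exact ⟨u, hmu, h⟩
  obtain ⟨h1, h2⟩ := G.eqs_guard p hp m x hmx hxm fun y hy =>
    hmin y (by simpa using G.eqs_trans p hp _ _ _ hum hy)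
  obtain ⟨q, hq⟩ := (G.eqs_state p hp _ hmx).1
  obtain ⟨r', hr1, hr2⟩ := ht _ hum
  -- The constraint between `u` and `m` makes `r` also the subtree at `m`, where it derives to the
  -- label `q`.
  rw [hr] at hr1
  cases hr1
  obtain ⟨r', hr3, hW'⟩ := WTGc.exists_subtree?_of_treeWt_ne_zero hW hq
  cases hr2.symm.trans hr3
  by_contra hlt
  exact hL ⟨p, hp, m, x, hmx, h1, q, hq, fun e => h2 (e ▸ hq), r, not_le.1 hlt,
    WTGc.derivations_nonempty_of_treeWt_ne_zero hW'⟩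

open scoped Classical in
/-- The constrained positions with the subtrees of `t` as choice. -/
theorem isLinChoice_subtree? [Fintype Q] (hL : ¬ G.LargeDuplication)
    {p : Production rk Q} (hp : p ∈ G.prods) {t : RankedTree rk Empty} (ht : t.Satisfies p.eqs)
    (hW : G.treeWt t p.lhs ≠ 0) :
    G.IsLinChoice p fun w => if w ∈ p.constrained then t.subtree? w else none := by
  refine ⟨hp, fun w => ?_, ?_, ?_⟩
  · by_cases hw : w ∈ p.constrained
    · obtain ⟨v, hv, -⟩ := WTGc.mem_constrained.1 hw
      obtain ⟨r, hr, -⟩ := ht _ hv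
      simp only [hw, if_true, iff_true]
      rw [hr]
      rfl
    · simp [hw]
  · rintro ⟨u, v⟩ huv
    by_cases h : u = v
    · subst h; rfl
    · have h1 := WTGc.mem_constrained.2 ⟨v, huv, h⟩
      have h2 := WTGc.mem_constrained.2 ⟨u, G.eqs_symm p hp _ _ huv, Ne.symm h⟩
      obtain ⟨r, hr1, hr2⟩ := ht _ huv
      simp only [h1, h2, if_true]
      exact hr1.trans hr2.symm
  · intro w r hr
    by_cases hw : w ∈ p.constrained
    · simp only [hw, if_true] at hr
      refine ⟨height_le_of_not_largeDuplication hL hp ht hW hw hr, ?_⟩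
      obtain ⟨v, hv, -⟩ := WTGc.mem_constrained.1 hw
      obtain ⟨q, hq⟩ := (G.eqs_state p hp _ hv).1
      obtain ⟨r', hr', hW'⟩ := WTGc.exists_subtree?_of_treeWt_ne_zero hW hq
      cases hr.symm.trans hr'
      exact ⟨q, hq, WTGc.derivations_nonempty_of_treeWt_ne_zero hW'⟩
    · simp [hw] at hr

theorem satisfies_of_isLinChoice [Fintype Q] {p : Production rk Q}
    {θ : List ℕ → Option (RankedTree rk Empty)} (hθ : G.IsLinChoice p θ)
    {t : RankedTree rk Empty} (h : ∀ w ∈ p.constrained, θ w = t.subtree? w)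
    (hW : G.treeWt t p.lhs ≠ 0) : t.Satisfies p.eqs := by
  rintro ⟨u, v⟩ huv
  obtain ⟨q, hq⟩ := (G.eqs_state p hθ.1 _ huv).1
  -- Even a trivial constraint `(u, u)` demands that `u` be a position of `t`; the nonzero weight
  -- supplies this.
  obtain ⟨r, hr, -⟩ := WTGc.exists_subtree?_of_treeWt_ne_zero hW hq
  refine ⟨r, hr, ?_⟩
  by_cases he : u = v
  · subst he; exact hr
  · have h1 := WTGc.mem_constrained.2 ⟨v, huv, he⟩
    have h2 := WTGc.mem_constrained.2 ⟨u, G.eqs_symm p hθ.1 _ _ huv, Ne.symm he⟩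
    show t.subtree? v = some r
    rw [← h v h2, ← hθ.2.2.1 _ huv, h u h1]
    exact hr

end WTGh

/-! ### Comparison of the linearization with the grammar. -/

namespace WTGc

variable {S : Type*} {rk : S → ℕ} {Q : Type*}

open scoped Classical in
-- Distinct pairs of production and choice may yield the same linearized production. Its weight is
-- the sum over that fibre, so the sum over productions unfolds to a sum over pairs.
theorem treeWt_lin_leaf [Finite S] [Fintype Q] (G : WTGc rk Q) (t : RankedTree rk Empty) (q : Q) :
    G.lin.treeWt t (leaf q) = ∑ x ∈ G.finite_linChoices.toFinset with x.1.tgt = q,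
      G.linWt x.1 x.2 * G.lin.treeWt t (linProduction x.1 x.2).lhs := by
  rw [treeWt_leaf, ← Finset.sum_fiberwise_of_maps_to (s := G.finite_linChoices.toFinset.filter
    fun x => x.1.tgt = q) (g := fun x => linProduction x.1 x.2)
    (t := G.lin.prods.filter fun p => p.tgt = q ∧ t.Satisfies p.eqs)]
  · refine Finset.sum_congr rfl fun p' hp' => ?_
    have hset : {x : Production rk Q × (List ℕ → Option (RankedTree rk Empty)) |
        G.IsLinChoice x.1 x.2 ∧ linProduction x.1 x.2 = p'} =
        ↑((G.finite_linChoices.toFinset.filter fun x => x.1.tgt = q).filter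
          fun x => linProduction x.1 x.2 = p') := by
      ext x
      simp only [Finset.coe_filter, Set.mem_ofPred_eq, Finset.mem_filter, Set.Finite.mem_toFinset]
      constructor
      · rintro ⟨h1, rfl⟩
        exact ⟨⟨h1, (Finset.mem_filter.1 hp').2.1⟩, rfl⟩
      · rintro ⟨⟨h1, -⟩, h2⟩
        exact ⟨h1, h2⟩
    have : G.lin.wt p' = ∑ x ∈ (G.finite_linChoices.toFinset.filter fun x => x.1.tgt = q).filter
        fun x => linProduction x.1 x.2 = p', G.linWt x.1 x.2 := by
      rw [← finsum_mem_coe_finset, ← hset]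
      rfl
    rw [this, Finset.sum_mul]
    refine Finset.sum_congr rfl fun x hx => ?_
    rw [(Finset.mem_filter.1 hx).2]
  · intro x hx
    simp only [Finset.mem_filter, Set.Finite.mem_toFinset] at hx
    refine Finset.mem_filter.2 ⟨?_, hx.2, ?_⟩
    · exact (Set.Finite.mem_toFinset _).2 ⟨x, hx.1, rfl⟩
    · intro e he
      exact absurd he (Finset.notMem_empty e)

end WTGc

namespace WTGh

variable {S : Type*} {rk : S → ℕ} {Q : Type*} {G : WTGh rk Q}

theorem treeWt_lin [Finite S] [Fintype Q] (hL : ¬ G.LargeDuplication)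
    (t : RankedTree rk Empty) (q : Q) : G.lin.treeWt t (leaf q) = G.treeWt t (leaf q) := by
  classical
  -- The state leaves of a left-hand side can lie arbitrarily deep, so the induction must cover all
  -- subtrees and not only the direct ones.
  suffices h : ∀ w t', t.subtree? w = some t' →
      ∀ q, G.lin.treeWt t' (leaf q) = G.treeWt t' (leaf q) from h [] t (subtree?_nil t) q
  clear q
  induction t with
  | leaf z => exact z.elim
  | node s ts ih =>
    intro w t' hw q
    cases w with
    | cons i w =>
      obtain ⟨j, rfl, hj⟩ := exists_of_subtree?_node_cons hw
      exact ih j w t' hj q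
    | nil =>
      simp only [subtree?_nil, Option.some.injEq] at hw
      subst hw
      have key : ∀ x ∈ G.finite_linChoices.toFinset.filter (fun x => x.1.tgt = q),
          G.linWt x.1 x.2 * G.lin.treeWt (node s ts) (WTGc.linProduction x.1 x.2).lhs =
          if ∀ w ∈ x.1.constrained, x.2 w = (node s ts).subtree? w then
            G.wt x.1 * G.treeWt (node s ts) x.1.lhs else 0 := by
        rintro ⟨p, θ⟩ hx
        simp only [Finset.mem_filter, Set.Finite.mem_toFinset, Set.mem_ofPred_eq] at hx
        rw [WTGc.linWt_eq, mul_assoc, WTGc.linProduction,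
          WTGc.prod_linFactor_mul_treeWt_fill G.lin p.lhs p.constrained ?_ θ hx.1.2.1, mul_ite,
          mul_zero]
        · intro w q' t' h1 h2
          cases w with
          | nil =>
            simp only [subtree?_nil, Option.some.injEq] at h1
            exact absurd h1 (G.lhs_not_state p hx.1.1 q')
          | cons i w =>
            obtain ⟨j, rfl, hj⟩ := exists_of_subtree?_node_cons h2
            exact ih j w t' hj q'
        · intro w hw
          obtain ⟨v, hv, -⟩ := WTGc.mem_constrained.1 hw
          exact (G.eqs_state p hx.1.1 _ hv).1
      rw [WTGc.treeWt_lin_leaf, Finset.sum_congr rfl key, WTGc.treeWt_leaf]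
      -- Among the nonzero terms each production occurs with exactly one choice, the one read off
      -- from `t`.
      refine Finset.sum_bij_ne_zero (fun x _ _ => x.1) ?_ ?_ ?_ ?_
      · rintro ⟨p, θ⟩ hx h0
        simp only [Finset.mem_filter, Set.Finite.mem_toFinset, Set.mem_ofPred_eq] at hx
        rw [ite_ne_right_iff] at h0
        exact Finset.mem_filter.2 ⟨hx.1.1, hx.2,
          satisfies_of_isLinChoice hx.1 h0.1 (right_ne_zero_of_mul h0.2)⟩
      · rintro ⟨p, θ⟩ hx h0 ⟨p', θ'⟩ hx' h0' h
        simp only [Finset.mem_filter, Set.Finite.mem_toFinset, Set.mem_ofPred_eq] at hx hx' h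
        subst h
        rw [ite_ne_right_iff] at h0 h0'
        refine Prod.ext rfl (funext fun w => ?_)
        show θ w = θ' w
        by_cases hw : w ∈ p.constrained
        · exact (h0.1 w hw).trans (h0'.1 w hw).symm
        · have h1 := (hx.1.2.1 w).not.2 hw
          have h2 := (hx'.1.2.1 w).not.2 hw
          rw [Option.not_isSome_iff_eq_none] at h1 h2
          rw [h1, h2]
      · intro p hp h0
        rw [Finset.mem_filter] at hp
        have hc := isLinChoice_subtree? hL hp.1 hp.2.2 (right_ne_zero_of_mul h0)
        refine ⟨(p, _), Finset.mem_filter.2 ⟨(Set.Finite.mem_toFinset _).2 hc, hp.2.1⟩, ?_, rfl⟩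
        rw [if_pos]
        · exact h0
        · intro w hw
          exact if_pos hw
      · rintro ⟨p, θ⟩ hx h0
        rw [ite_ne_right_iff] at h0
        exact if_pos h0.1

theorem sem_lin [Finite S] [Fintype Q] (hL : ¬ G.LargeDuplication) : G.lin.sem = G.sem := by
  funext t
  rw [WTGc.sem_eq, WTGc.sem_eq]
  simp only [treeWt_lin hL]
  rfl

end WTGh

theorem WTGc.isWTG_lin {S : Type*} {rk : S → ℕ} {Q : Type*} [Finite S] [Fintype Q]
    (G : WTGc rk Q) : G.lin.IsWTG := by
  intro p hp
  obtain ⟨x, -, rfl⟩ := (Set.Finite.mem_toFinset _).1 hp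
  rfl

/-! ### From grammars without constraints to automata. -/

namespace RankedTree

variable {S : Type*} {rk : S → ℕ} {Z : Type*}

theorem finite_subtrees (t : RankedTree rk Z) : {r | ∃ w, t.subtree? w = some r}.Finite := by
  induction t with
  | leaf z =>
    refine (Set.finite_singleton (leaf z)).subset ?_
    rintro r ⟨_ | ⟨i, w⟩, h⟩
    · simpa using h.symm
    · cases h
  | node s ts ih =>
    refine ((Set.finite_iUnion ih).insert (node s ts)).subset ?_
    rintro r ⟨_ | ⟨i, w⟩, h⟩
    · exact .inl (by simpa using h.symm)
    · obtain ⟨j, rfl, hj⟩ := exists_of_subtree?_node_cons h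
      exact .inr (Set.mem_iUnion.2 ⟨j, w, hj⟩)

/-- Replace every leaf `y` by the tree `f y`. -/
def bindLeaves {Y : Type*} (f : Y → RankedTree rk Z) : RankedTree rk Y → RankedTree rk Z
  | leaf y => f y
  | node s ts => node s fun i => (ts i).bindLeaves f

end RankedTree

namespace WTGc

variable {S : Type*} {rk : S → ℕ} {Q : Type*}

/-- The states and the subtrees of left-hand sides of productions of `G`. -/
def lhsSubtrees (G : WTGc rk Q) : Set (RankedTree rk Q) :=
  Set.range leaf ∪ ⋃ p ∈ G.prods, {r | ∃ w, p.lhs.subtree? w = some r}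

theorem finite_lhsSubtrees [Finite Q] (G : WTGc rk Q) : G.lhsSubtrees.Finite :=
  (Set.finite_range _).union
    (Set.Finite.biUnion G.prods.finite_toSet fun p _ => p.lhs.finite_subtrees)

theorem mem_lhsSubtrees_of_node {G : WTGc rk Q} {s : S} {ls : Fin (rk s) → RankedTree rk Q}
    (h : node s ls ∈ G.lhsSubtrees) (i : Fin (rk s)) : ls i ∈ G.lhsSubtrees := by
  rcases h with ⟨q, hq⟩ | h
  · cases hq
  · simp only [Set.mem_iUnion] at h
    obtain ⟨p, hp, w, hw⟩ := h
    refine .inr (Set.mem_biUnion hp ⟨w ++ [(i : ℕ)], ?_⟩)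
    rw [subtree?_append hw]
    simp

theorem lhs_mem_lhsSubtrees {G : WTGc rk Q} {p : Production rk Q} (hp : p ∈ G.prods) :
    p.lhs ∈ G.lhsSubtrees :=
  .inr (Set.mem_biUnion hp ⟨[], subtree?_nil _⟩)

/-- The production `s(j₁, …, jₖ) → k`. -/
def flatProduction {X : Type*} (x : Σ s : S, (Fin (rk s) → X) × X) : Production rk X where
  lhs := node x.1 fun i => leaf (x.2.1 i)
  tgt := x.2.2
  eqs := ∅

theorem flatProduction_injective {X : Type*} :
    Function.Injective (flatProduction (rk := rk) (X := X)) := by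
  rintro ⟨s, j, k⟩ ⟨s', j', k'⟩ h
  simp only [flatProduction, Production.mk.injEq, node.injEq] at h
  obtain ⟨⟨rfl, h⟩, rfl, -⟩ := h
  simp only [heq_eq_eq, funext_iff, leaf.injEq] at h
  obtain rfl := funext h
  rfl

open scoped Classical in
/-- The weight of `s(r₁, …, rₖ) → r` when the trees `rᵢ` and `r` serve as states. -/
noncomputable def flatWt (G : WTGc rk Q) (l : RankedTree rk Q) : RankedTree rk Q → ℕ
  | leaf q => if (⟨l, q, ∅⟩ : Production rk Q) ∈ G.prods then G.wt ⟨l, q, ∅⟩ else 0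
  | node s ls => if l = node s ls then 1 else 0

/-- The automaton whose states `k` stand for the trees `dec k`. -/
noncomputable def flatten [Finite S] (G : WTGc rk Q) {X : Type*} [Finite X]
    (dec : X → RankedTree rk Q) : WTGc rk X where
  final k := match dec k with
    | leaf q => G.final q
    | node _ _ => 0
  prods := (Set.finite_range (flatProduction (rk := rk) (X := X))).toFinset
  lhs_not_state := by
    intro p hp q hq
    obtain ⟨x, rfl⟩ := (Set.Finite.mem_toFinset _).1 hp
    cases hq
  wt p := G.flatWt (p.lhs.bindLeaves dec) (dec p.tgt)

theorem isWTA_flatten [Finite S] (G : WTGc rk Q) {X : Type*} [Finite X]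
    (dec : X → RankedTree rk Q) : (G.flatten dec).IsWTA := by
  refine ⟨fun p hp => ?_, fun p hp => ?_⟩
  · obtain ⟨x, rfl⟩ := (Set.Finite.mem_toFinset _).1 hp
    rfl
  · obtain ⟨x, rfl⟩ := (Set.Finite.mem_toFinset _).1 hp
    ext w
    simp only [symbolPos, flatProduction, Set.mem_ofPred_eq, Set.mem_singleton_iff]
    constructor
    · rintro ⟨s, ts, h⟩
      cases w with
      | nil => rfl
      | cons i w =>
        obtain ⟨j, rfl, hj⟩ := exists_of_subtree?_node_cons h
        cases w with
        | nil => simp at hj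
        | cons i w => cases hj
    · rintro rfl
      exact ⟨_, _, subtree?_nil _⟩

theorem treeWt_flatten_leaf [Finite S] (G : WTGc rk Q) {X : Type*} [Fintype X]
    (dec : X → RankedTree rk Q) (s : S) (ts : Fin (rk s) → RankedTree rk Empty) (k : X) :
    (G.flatten dec).treeWt (node s ts) (leaf k) =
      ∑ j : Fin (rk s) → X, G.flatWt (node s fun i => dec (j i)) (dec k) *
        ∏ i, (G.flatten dec).treeWt (ts i) (leaf (j i)) := by
  classical
  rw [treeWt_leaf]
  symm
  refine Finset.sum_of_injOn (fun j => flatProduction ⟨s, j, k⟩) ?_ ?_ ?_ ?_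
  · intro j _ j' _ h
    have := flatProduction_injective h
    simpa using this
  · intro j _
    simp only [Finset.coe_filter, Set.mem_ofPred_eq]
    exact ⟨(Set.Finite.mem_toFinset _).2 ⟨_, rfl⟩, rfl, fun e he => absurd he (Finset.notMem_empty e)⟩
  · intro p hp hn
    rw [Finset.mem_filter] at hp
    obtain ⟨⟨s', j, k'⟩, rfl⟩ := (Set.Finite.mem_toFinset _).1 hp.1
    by_cases h : s = s'
    · subst h
      refine absurd ⟨j, by simp, ?_⟩ hn
      have : k' = k := hp.2.1
      rw [this]
    · rw [flatProduction, treeWt_node_of_ne h, mul_zero]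
  · intro j _
    show _ = G.flatWt _ _ * (G.flatten dec).treeWt (node s ts) (node s fun i => leaf (j i))
    rw [treeWt_node]
    rfl

/-- The state for `r` collects the weight of reaching `r`. Moving from `r₁, …, rₖ` to `s(r₁, …, rₖ)`
costs 1, and moving to a state `q` costs the weight of the production `s(r₁, …, rₖ) → q`, so each
production weight is charged once, at the root of its left-hand side. All other transitions have
weight 0. -/
theorem treeWt_flatten [Finite S] {G : WTGc rk Q} (hG : G.IsWTG) {X : Type*} [Fintype X]
    {dec : X → RankedTree rk Q} (hinj : Function.Injective dec)
    (hrange : Set.range dec = G.lhsSubtrees) (t : RankedTree rk Empty) (k : X) :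
    (G.flatten dec).treeWt t (leaf k) = G.treeWt t (dec k) := by
  classical
  induction t generalizing k with
  | leaf z => exact z.elim
  | node s ts ih =>
    rw [treeWt_flatten_leaf]
    simp only [ih]
    -- Closure under direct subtrees guarantees that every intermediate tree has an encoding;
    -- injectivity of `dec` makes it unique.
    have hsurj : ∀ ls : Fin (rk s) → RankedTree rk Q, node s ls ∈ G.lhsSubtrees →
        ∃ j : Fin (rk s) → X, ls = fun i => dec (j i) := by
      intro ls h
      have := fun i => mem_lhsSubtrees_of_node h i
      simp only [← hrange, Set.mem_range] at this
      choose j hj using this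
      exact ⟨j, funext fun i => (hj i).symm⟩
    have hinj' : ∀ j j' : Fin (rk s) → X, (fun i => dec (j i)) = (fun i => dec (j' i)) → j = j' :=
      fun j j' h => funext fun i => hinj (congrFun h i)
    have hk : dec k ∈ G.lhsSubtrees := hrange ▸ Set.mem_range_self k
    rcases hd : dec k with q | ⟨s', ls⟩
    · simp only [flatWt, ← treeWt_node]
      rw [treeWt_leaf]
      refine Finset.sum_bij_ne_zero (fun j _ _ => ⟨node s fun i => dec (j i), q, ∅⟩) ?_ ?_ ?_ ?_
      · intro j _ h0
        have := left_ne_zero_of_mul h0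
        rw [ite_ne_right_iff] at this
        exact Finset.mem_filter.2
          ⟨this.1, rfl, fun e he => absurd he (Finset.notMem_empty e)⟩
      · intro j _ _ j' _ _ h
        simp only [Production.mk.injEq, node.injEq, heq_eq_eq, true_and, and_true] at h
        exact hinj' j j' h
      · rintro ⟨l, q', E⟩ hp h0
        rw [Finset.mem_filter] at hp
        obtain ⟨hp, rfl, -⟩ := hp
        obtain rfl : E = ∅ := hG _ hp
        cases l with
        | leaf z => exact absurd rfl (G.lhs_not_state _ hp z)
        | node s' ls =>
          by_cases hs : s = s'
          · subst hs
            obtain ⟨j, rfl⟩ := hsurj ls (lhs_mem_lhsSubtrees hp)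
            refine ⟨j, Finset.mem_univ j, ?_, rfl⟩
            rw [if_pos hp]
            exact h0
          · exact absurd (by rw [treeWt_node_of_ne hs, mul_zero]) h0
      · intro j _ h0
        have := left_ne_zero_of_mul h0
        rw [ite_ne_right_iff] at this
        rw [if_pos this.1]
    · simp only [flatWt]
      by_cases hs : s = s'
      · subst hs
        obtain ⟨j, rfl⟩ := hsurj ls (hd ▸ hk)
        rw [Finset.sum_eq_single j]
        · rw [if_pos rfl, one_mul, treeWt_node]
        · intro j' _ hne
          rw [if_neg, zero_mul]
          intro h
          simp only [node.injEq, heq_eq_eq, true_and] at h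
          exact hne (hinj' _ _ h)
        · simp
      · rw [treeWt_node_of_ne hs]
        refine Finset.sum_eq_zero fun j _ => ?_
        rw [if_neg, zero_mul]
        intro h
        cases h
        exact hs rfl

theorem sem_flatten [Finite S] [Fintype Q] {G : WTGc rk Q} (hG : G.IsWTG) {X : Type*} [Fintype X]
    {dec : X → RankedTree rk Q} (hinj : Function.Injective dec)
    (hrange : Set.range dec = G.lhsSubtrees) : (G.flatten dec).sem = G.sem := by
  classical
  funext t
  rw [sem_eq, sem_eq]
  have hex : ∀ q, ∃ k, dec k = leaf q := by
    intro q
    show leaf q ∈ Set.range dec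
    rw [hrange]
    exact .inl ⟨q, rfl⟩
  choose c hc using hex
  symm
  refine Finset.sum_of_injOn c ?_ (by simp) ?_ ?_
  · intro q _ q' _ h
    have := congrArg dec h
    rw [hc, hc] at this
    exact leaf.inj this
  · intro k _ hk
    rcases hd : dec k with q | ⟨s, ls⟩
    · exact absurd ⟨q, by simp, hinj ((hc q).trans hd.symm)⟩ hk
    · simp [flatten, hd]
  · intro q _
    rw [treeWt_flatten hG hinj hrange, hc]
    simp [flatten, hc]

theorem IsWTG.isRegularWTL [Finite S] [Fintype Q] {G : WTGc rk Q} (hG : G.IsWTG) :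
    IsRegularWTL G.sem := by
  -- Regularity asks for a state set in `Type`, whereas the trees live in the universes of `S` and
  -- `Q`; numbering them by `Fin n` bridges this.
  obtain ⟨n, ⟨e⟩⟩ := @Finite.exists_equiv_fin _ G.finite_lhsSubtrees.to_subtype
  refine ⟨Fin n, inferInstance, G.flatten fun k => (e.symm k : RankedTree rk Q),
    G.isWTA_flatten _, sem_flatten hG (Subtype.val_injective.comp e.symm.injective) ?_⟩
  rw [show (fun k => (e.symm k : RankedTree rk Q)) = Subtype.val ∘ e.symm from rfl,
    e.symm.surjective.range_comp, Subtype.range_coe]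

end WTGc

theorem mainTheorem3 {S : Type*} [Finite S] (rk : S → ℕ) {Q : Type*} [Fintype Q]
    (G : WTGh rk Q) (hG : G.IsTrim) (hL : ¬ G.LargeDuplication) :
    IsRegularWTL G.sem ∧ G.lin.IsWTG ∧ G.lin.sem = G.sem :=
  ⟨WTGh.sem_lin hL ▸ G.toWTGc.isWTG_lin.isRegularWTL, G.toWTGc.isWTG_lin, WTGh.sem_lin hL⟩
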